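/- Let $R$ be a commutative ring, $x\in R$, $M$ an $R$-module, and $\{M_n\}_{n\ge 1}$ a decreasing sequence of submodules of $M$. For a set $S$ and a module $N$ put $N^{(S)}=\bigoplus_{s\in S}N$, and let $N[T]$ denote the module of polynomials with coefficients in $N$. Put $\Lambda(\mathcal M^{(S)})=\varprojlim_n M^{(S)}/M_n^{(S)}$ and $\Lambda((\mathcal M/x\mathcal M)^{(S)})=\varprojlim_n M^{(S)}/(x^nM+M_n)^{(S)}$. For an $R$-module $N$ and $a \in R$ let $H_1(a;N)=\ker(N\xrightarrow{a}N)$ be the first Koszul homology. For an inverse system $\{Y_n\}_{n\ge1}$ of $R$-modules, $\{H_1(x^n;Y_n)\}_{n\ge1}$ is the inverse system whose transition map $H_1(x^m;Y_m)\to H_1(x^n;Y_n)$, $m\ge n$, is $Y_m\to Y_n$ followed by multiplication by $x^{m-n}$. An inverse system is pro-zero if for every $n$ there is $m\ge n$ such that the transition map from index $m$ to index $n$ is zero. For an inverse system $\{Y_n\}_{n\ge1}$, $\varprojlim^1Y_n$ is the cokernel of $\prod_n Y_n\to\prod_n Y_n$, $(a_n)\mapsto(a_n-\phi_{n,n+1}(a_{n+1}))$,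 where $\phi_{n,n+1}:Y_{n+1}\to Y_n$ is the transition map. Let $L_x$ be the complex $0\to R[T]\oplus R\to R[T]\to0$ in cohomological degrees $0,1$ with differential $(f,r)\mapsto r-(1-xT)f$, which is a free resolution of the Čech complex $0\to R\to R_x\to0$, and let $\check H_i^x(N)=H_i(\mathrm{Hom}_R(L_x,N))$ be the Čech homology. There is a natural homomorphism $\check H_0^x(\Lambda(\mathcal M^{(S)}))\to\Lambda((\mathcal M/x\mathcal M)^{(S)})$, whose $n$-th component is the composite of the natural maps $\check H_0^x(\Lambda(\mathcal M^{(S)}))\to\Lambda(\mathcal M^{(S)})/x^n\Lambda(\mathcal M^{(S)})\to M^{(S)}/(x^nM+M_n)^{(S)}$; here the first map is induced by the map of complexes from $0\to R\xrightarrow{x^n}R\to0$ to $L_x$ given by $1\mapsto(\sum_{i<n}x^iT^i,1)$ in degree $0$ and $1\mapsto T^n$ in degree $1$. Then the following conditions are equivalent: 1. The inverse system $\{H_1(x^n;M/M_n)\}_{n\ge1}$ is pro-zero. 2. For every set $S$, $\check H_1^x(\Lambda(\mathcal M^{(S)}))=0$ and the natural homomorphism $\check H_0^x(\Lambda(\mathcal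 M^{(S)}))\to\Lambda((\mathcal M/x\mathcal M)^{(S)})$ is an isomorphism. 3. The condition in 2 holds for $S$ a set with a single element and for $S=\mathbb N$. 4. $\varprojlim H_1(x^n;Y_n)=\varprojlim^1H_1(x^n;Y_n)=0$ for both $Y_n=M/M_n$ and $Y_n=(M/M_n)[T]$. 5. $\varprojlim H_1(x^n;(M/M_n)[T])=\varprojlim^1H_1(x^n;(M/M_n)[T])=0$. -/

import Mathlib

universe u v w

open Polynomial

/-- An inverse system `{Yₙ}_{n ≥ 1}` of `R`-modules, indexed by the positive integers, with
transition maps `Yₘ → Yₙ` for `n ≤ m`. -/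
structure ModuleTower (R : Type u) [CommRing R] where
  obj : ℕ+ → Type v
  [addCommGroup : ∀ n, AddCommGroup (obj n)]
  [module : ∀ n, Module R (obj n)]
  map : ∀ {n m : ℕ+}, n ≤ m → (obj m →ₗ[R] obj n)
  map_refl : ∀ (n : ℕ+) (y : obj n), map (le_refl n) y = y
  map_map : ∀ {k n m : ℕ+} (h : k ≤ n) (h' : n ≤ m) (y : obj m),
    map h (map h' y) = map (h.trans h') y

attribute [instance] ModuleTower.addCommGroup ModuleTower.module

namespace ModuleTower

variable {R : Type u} [CommRing R]

/-- For each `n` there is `m ≥ n` such that the transition map `Yₘ → Yₙ` is zero. -/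
def IsProZero (Y : ModuleTower.{u, v} R) : Prop :=
  ∀ n : ℕ+, ∃ (m : ℕ+) (h : n ≤ m), Y.map h = 0

/-- The inverse limit, as the module of compatible families. -/
def lim (Y : ModuleTower.{u, v} R) : Submodule R (∀ n, Y.obj n) where
  carrier := {a | ∀ (n m : ℕ+) (h : n ≤ m), Y.map h (a m) = a n}
  add_mem' ha hb n m h := by simp [ha n m h, hb n m h]
  zero_mem' n m h := by simp
  smul_mem' r a ha n m h := by simp [ha n m h]

/-- The map `Φ : ∏ Yₙ → ∏ Yₙ`, `(aₙ) ↦ (aₙ - φ_{n,n+1}(aₙ₊₁))`. -/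
def phi (Y : ModuleTower.{u, v} R) : (∀ n, Y.obj n) →ₗ[R] (∀ n, Y.obj n) :=
  LinearMap.pi fun n =>
    LinearMap.proj n - (Y.map (PNat.lt_add_right n 1).le).comp (LinearMap.proj (n + 1))

/-- `lim¹ Yₙ`, the cokernel of `Φ`. -/
abbrev lim1 (Y : ModuleTower.{u, v} R) : Type v :=
  (∀ n, Y.obj n) ⧸ LinearMap.range Y.phi

/-- The projection of the inverse limit to its `n`-th term. -/
def limProj (Y : ModuleTower.{u, v} R) (n : ℕ+) : Y.lim →ₗ[R] Y.obj n :=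
  (LinearMap.proj n).comp Y.lim.subtype

/-- The inverse system `{Yₙ[T]}` of polynomial modules. -/
noncomputable def polynomial (Y : ModuleTower.{u, v} R) : ModuleTower.{u, v} R where
  obj n := PolynomialModule R (Y.obj n)
  map h := PolynomialModule.map R (Y.map h)
  map_refl n y := by
    ext i
    simp [PolynomialModule.map, Y.map_refl]
  map_map h h' y := by
    ext i
    simp [PolynomialModule.map, Y.map_map]

end ModuleTower

/-! ### Koszul homology of one element -/

section Koszul

variable {R : Type u} [CommRing R]

/-- `H₁(a; N)` for the Koszul complex `0 → N → N → 0` with differential multiplication by `a`: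
the kernel of the differential. -/
abbrev koszulH1 (a : R) (N : Type v) [AddCommGroup N] [Module R N] : Submodule R N :=
  LinearMap.ker (LinearMap.lsmul R N a)

/-- `H₀(a; N) = N / aN`: the cokernel of the differential of the Koszul complex. -/
abbrev koszulH0 (a : R) (N : Type v) [AddCommGroup N] [Module R N] : Type v :=
  N ⧸ LinearMap.range (LinearMap.lsmul R N a)

/-- The inverse system `{H₁(xⁿ; Yₙ)}`. The transition map from `m` to `n` is induced by `Yₘ → Yₙ`
and the natural map of Koszul complexes from `xᵐ` to `xⁿ`, which is multiplication by `xᵐ⁻ⁿ`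
in degree `1` and the identity in degree `0`. -/
def koszulH1Tower (x : R) (Y : ModuleTower.{u, v} R) : ModuleTower.{u, v} R where
  obj n := koszulH1 (x ^ (n : ℕ)) (Y.obj n)
  map {n m} h := ((LinearMap.lsmul R (Y.obj n) (x ^ ((m : ℕ) - (n : ℕ)))).comp
      (Y.map h)).restrict (p := koszulH1 (x ^ (m : ℕ)) (Y.obj m))
      (q := koszulH1 (x ^ (n : ℕ)) (Y.obj n)) (by
        intro y hy
        have h1 : x ^ (m : ℕ) • y = 0 := by simpa using hy
        have h2 : (n : ℕ) + ((m : ℕ) - (n : ℕ)) = m := Nat.add_sub_cancel' h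
        simp only [LinearMap.mem_ker, LinearMap.comp_apply, LinearMap.lsmul_apply]
        rw [smul_smul, ← pow_add, h2, ← map_smul, h1, map_zero])
  map_refl n y := by
    ext
    simp [Y.map_refl]
  map_map {k n m} h h' y := by
    have h1 : (k : ℕ) ≤ n := h
    have h2 : (n : ℕ) ≤ m := h'
    have h3 : ((m : ℕ) - n) + ((n : ℕ) - k) = (m : ℕ) - k := by omega
    ext
    simp only [LinearMap.coe_restrict_apply, LinearMap.comp_apply, LinearMap.lsmul_apply,
      map_smul, Y.map_map]
    rw [smul_smul, ← pow_add, h3]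

end Koszul

/-! ### Čech homology of one element -/

section Cech

variable {R : Type u} [CommRing R]

/-- The bounded free resolution `L_x : 0 → R[T] ⊕ R → R[T] → 0` (in cohomological degrees `0`, `1`)
of the Čech complex `0 → R → R_x → 0`, with differential `(f, r) ↦ r - (1 - xT) f`.
The quasi-isomorphism to the Čech complex is `(f, r) ↦ r` in degree `0`, and `T ↦ 1/x`
(so that `R[T]/(1 - xT) ≅ R_x`) in degree `1`. -/
noncomputable def cechResolution (x : R) : (R[X] × R) →ₗ[R] R[X] :=
  (Algebra.linearMap R R[X]).comp (LinearMap.snd R R[X] R) -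
    (LinearMap.mulLeft R (1 - C x * X)).comp (LinearMap.fst R R[X] R)

/-- The only nonzero differential of `Hom_R(L_x, N)`, going from homological degree `1` to `0`. -/
noncomputable abbrev cechDifferential (x : R) (N : Type v) [AddCommGroup N] [Module R N] :
    (R[X] →ₗ[R] N) →ₗ[R] ((R[X] × R) →ₗ[R] N) :=
  LinearMap.lcomp R N (cechResolution x)

/-- Čech homology `Ȟ₁ˣ(N) = H₁(Hom_R(L_x, N))`. -/
noncomputable abbrev cechH1 (x : R) (N : Type v) [AddCommGroup N] [Module R N] :
    Submodule R (R[X] →ₗ[R] N) :=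
  LinearMap.ker (cechDifferential x N)

/-- Čech homology `Ȟ₀ˣ(N) = H₀(Hom_R(L_x, N))`. -/
noncomputable abbrev cechH0 (x : R) (N : Type v) [AddCommGroup N] [Module R N] : Type (max u v) :=
  ((R[X] × R) →ₗ[R] N) ⧸ LinearMap.range (cechDifferential x N)

/-- The image in degree `0` of `1` under the map of complexes from the Koszul co-complex
`0 → R → R → 0` (differential `xⁿ`) to `L_x`: it is `(∑_{i<n} (xT)ⁱ, 1)` in degree `0`, and `Tⁿ`
in degree `1`. This map lifts the natural map from the Koszul co-complex to the Čech complex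
(`1 ↦ 1` in degree `0`, `1 ↦ 1/xⁿ` in degree `1`). -/
noncomputable def koszulToCech (x : R) (n : ℕ) : R[X] × R :=
  (∑ i ∈ Finset.range n, (C x * X) ^ i, 1)

/-- The map `koszulToCech` commutes with the differentials. -/
theorem cechResolution_koszulToCech (x : R) (n : ℕ) :
    cechResolution x (koszulToCech x n) = x ^ n • (X : R[X]) ^ n := by
  have h := mul_neg_geom_sum (C x * X : R[X]) n
  simp only [cechResolution, koszulToCech, LinearMap.sub_apply, LinearMap.comp_apply,
    LinearMap.snd_apply, LinearMap.fst_apply, LinearMap.mulLeft_apply, Algebra.linearMap_apply,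
    map_one]
  rw [h, sub_sub_cancel, mul_pow, smul_eq_C_mul, C_pow]

/-- The natural map `Ȟ₀ˣ(N) → H₀(xⁿ; N) = N / xⁿN`, induced by `koszulToCech`. -/
noncomputable def cechToKoszulH0 (x : R) (n : ℕ) (N : Type v) [AddCommGroup N] [Module R N] :
    cechH0 x N →ₗ[R] koszulH0 (x ^ n) N :=
  Submodule.mapQ _ _ (LinearMap.applyₗ (koszulToCech x n)) (by
    rintro _ ⟨φ, rfl⟩
    refine ⟨φ ((X : R[X]) ^ n), ?_⟩
    simp [cechResolution_koszulToCech])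

/-- The maps `cechToKoszulH0` are compatible, for varying `n`. -/
theorem cechToKoszulH0_compatible (x : R) (N : Type v) [AddCommGroup N] [Module R N]
    {n m : ℕ} (hnm : n ≤ m) (g : (R[X] × R) →ₗ[R] N) :
    ∃ y : N, g (koszulToCech x m) = g (koszulToCech x n) + x ^ n • y := by
  induction m, hnm using Nat.le_induction with
  | base => exact ⟨0, by simp⟩
  | succ m hm ih =>
    obtain ⟨y, hy⟩ := ih
    have h1 : koszulToCech x (m + 1) =
        koszulToCech x m + x ^ n • (x ^ (m - n) • ((X : R[X]) ^ m, (0 : R))) := by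
      rw [smul_smul, ← pow_add, Nat.add_sub_cancel' hm]
      ext1
      · simp [koszulToCech, Finset.sum_range_succ, mul_pow, smul_eq_C_mul]
      · simp [koszulToCech]
    refine ⟨y + g (x ^ (m - n) • ((X : R[X]) ^ m, (0 : R))), ?_⟩
    rw [h1, map_add, hy, map_smul g (x ^ n), smul_add, add_assoc]

end Cech

/-! ### Completions with respect to a filtration -/

section Filtration

variable {R : Type u} [CommRing R] {M : Type v} [AddCommGroup M] [Module R M]

/-- The inverse system `{M/Mₙ}` of a decreasing sequence of submodules. -/
abbrev quotientTower (F : ℕ+ → Submodule R M) (hF : Antitone F) : ModuleTower.{u, v} R where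
  obj n := M ⧸ F n
  map h := Submodule.factor (hF h)
  map_refl n y := by
    induction y using Submodule.Quotient.induction_on
    simp
  map_map h h' y := by
    induction y using Submodule.Quotient.induction_on
    simp

/-- The filtration `{Mₙ^(S)}` of `M^(S) = ⨁_{s ∈ S} M`. -/
noncomputable def directSumFiltration (S : Type w) (F : ℕ+ → Submodule R M) (n : ℕ+) : Submodule R (S →₀ M) :=
  Finsupp.submodule fun _ => F n

theorem directSumFiltration_antitone (S : Type w) {F : ℕ+ → Submodule R M} (hF : Antitone F) :
    Antitone (directSumFiltration S F) :=
  fun _ _ h _ hf s => hF h (hf s)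

/-- The induced filtration `{(xⁿM, Mₙ)}`. -/
def inducedFiltration (x : R) (F : ℕ+ → Submodule R M) (n : ℕ+) : Submodule R M :=
  LinearMap.range (LinearMap.lsmul R M (x ^ (n : ℕ))) ⊔ F n

theorem inducedFiltration_antitone (x : R) {F : ℕ+ → Submodule R M} (hF : Antitone F) :
    Antitone (inducedFiltration x F) := by
  intro n m h
  refine sup_le_sup ?_ (hF h)
  rintro _ ⟨y, rfl⟩
  refine ⟨x ^ ((m : ℕ) - (n : ℕ)) • y, ?_⟩
  have h2 : (n : ℕ) + ((m : ℕ) - (n : ℕ)) = m := Nat.add_sub_cancel' h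
  simp only [LinearMap.lsmul_apply]
  rw [smul_smul, ← pow_add, h2]

/-- `Λ(𝓜^(S)) = lim M^(S)/Mₙ^(S)`. -/
noncomputable abbrev completion (F : ℕ+ → Submodule R M) (hF : Antitone F) (S : Type w) :
    Submodule R (∀ n, (quotientTower (directSumFiltration S F)
      (directSumFiltration_antitone S hF)).obj n) :=
  (quotientTower (directSumFiltration S F) (directSumFiltration_antitone S hF)).lim

/-- `Λ((𝓜/x𝓜)^(S)) = lim M^(S)/(xⁿM, Mₙ)^(S)`. -/
noncomputable abbrev inducedCompletion (x : R) (F : ℕ+ → Submodule R M) (hF : Antitone F) (S : Type w) :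
    Submodule R (∀ n, (quotientTower (directSumFiltration S (inducedFiltration x F))
      (directSumFiltration_antitone S (inducedFiltration_antitone x hF))).obj n) :=
  completion (inducedFiltration x F) (inducedFiltration_antitone x hF) S

theorem directSumFiltration_le_induced (x : R) (F : ℕ+ → Submodule R M) (S : Type w) (n : ℕ+) :
    directSumFiltration S F n ≤ directSumFiltration S (inducedFiltration x F) n :=
  fun _ hf s => (le_sup_right : F n ≤ inducedFiltration x F n) (hf s)

/-- Multiples of `xⁿ` vanish in `M^(S)/(xⁿM, Mₙ)^(S)`. -/
theorem pow_smul_quotient_induced (x : R) (F : ℕ+ → Submodule R M) (S : Type w) (n : ℕ+)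
    (z : (S →₀ M) ⧸ directSumFiltration S (inducedFiltration x F) n) : x ^ (n : ℕ) • z = 0 := by
  induction z using Submodule.Quotient.induction_on with
  | H f =>
    rw [← Submodule.Quotient.mk_smul, Submodule.Quotient.mk_eq_zero]
    exact fun s => (le_sup_left : _ ≤ inducedFiltration x F n) ⟨f s, rfl⟩

/-- The natural map `Λ(𝓜^(S)) → M^(S)/Mₙ^(S) → M^(S)/(xⁿM, Mₙ)^(S)`. -/
noncomputable def completionProj (x : R) (F : ℕ+ → Submodule R M) (hF : Antitone F) (S : Type w)
    (n : ℕ+) :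
    completion F hF S →ₗ[R] (S →₀ M) ⧸ directSumFiltration S (inducedFiltration x F) n :=
  (Submodule.factor (directSumFiltration_le_induced x F S n)).comp (ModuleTower.limProj _ n)

theorem factor_completionProj (x : R) (F : ℕ+ → Submodule R M) (hF : Antitone F) (S : Type w)
    {n m : ℕ+} (h : n ≤ m) (a : completion F hF S) :
    Submodule.factor (directSumFiltration_antitone S (inducedFiltration_antitone x hF) h)
      (completionProj x F hF S m a) = completionProj x F hF S n a := by
  have h1 : ∀ z : (S →₀ M) ⧸ directSumFiltration S F m,
      Submodule.factor (directSumFiltration_antitone S (inducedFiltration_antitone x hF) h)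
        (Submodule.factor (directSumFiltration_le_induced x F S m) z) =
      Submodule.factor (directSumFiltration_le_induced x F S n)
        (Submodule.factor (directSumFiltration_antitone S hF h) z) := by
    intro z
    induction z using Submodule.Quotient.induction_on
    rfl
  exact (h1 (a.1 m)).trans
    (congrArg (Submodule.factor (directSumFiltration_le_induced x F S n)) (a.2 n m h))

/-- The natural map `Λ(𝓜^(S)) / xⁿ Λ(𝓜^(S)) → M^(S)/(xⁿM, Mₙ)^(S)`. -/
noncomputable def completionModPow (x : R) (F : ℕ+ → Submodule R M) (hF : Antitone F)
    (S : Type w) (n : ℕ+) :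
    koszulH0 (x ^ (n : ℕ)) (completion F hF S) →ₗ[R]
      (S →₀ M) ⧸ directSumFiltration S (inducedFiltration x F) n :=
  Submodule.liftQ _ (completionProj x F hF S n) (by
    rintro _ ⟨a, rfl⟩
    rw [LinearMap.mem_ker, LinearMap.lsmul_apply, map_smul]
    exact pow_smul_quotient_induced x F S n _)

/-- The natural map `Ȟ₀ˣ(Λ(𝓜^(S))) → Λ((𝓜/x𝓜)^(S))`. Its `n`-th component is the composite
`Ȟ₀ˣ(Λ(𝓜^(S))) → Λ(𝓜^(S)) / xⁿ Λ(𝓜^(S)) → M^(S)/(xⁿM, Mₙ)^(S)`. -/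
noncomputable def cechToInducedCompletion (x : R) (F : ℕ+ → Submodule R M) (hF : Antitone F)
    (S : Type w) :
    cechH0 x (completion F hF S) →ₗ[R] inducedCompletion x F hF S :=
  LinearMap.codRestrict _
    (LinearMap.pi fun n : ℕ+ => (completionModPow x F hF S n).comp
      (cechToKoszulH0 x (n : ℕ) (completion F hF S))) (by
    intro c n m h
    induction c using Submodule.Quotient.induction_on with
    | H g =>
      obtain ⟨y, hy⟩ := cechToKoszulH0_compatible x (completion F hF S)
        (show (n : ℕ) ≤ m from h) g
      refine (factor_completionProj x F hF S h (g (koszulToCech x m))).trans ?_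
      rw [hy, map_add, map_smul, pow_smul_quotient_induced x F S n, add_zero]
      rfl)

/-- `Ȟ₁ˣ(Λ(𝓜^(S))) = 0`, and the natural map `Ȟ₀ˣ(Λ(𝓜^(S))) → Λ((𝓜/x𝓜)^(S))` is an
isomorphism. -/
def CechCondition (x : R) (F : ℕ+ → Submodule R M) (hF : Antitone F) (S : Type w) : Prop :=
  Subsingleton (cechH1 x (completion F hF S)) ∧
    Function.Bijective (cechToInducedCompletion x F hF S)

/-- `lim H₁(xⁿ; Yₙ) = lim¹ H₁(xⁿ; Yₙ) = 0`. -/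
def KoszulLimVanish (x : R) (Y : ModuleTower.{u, v} R) : Prop :=
  Subsingleton (koszulH1Tower x Y).lim ∧ Subsingleton (koszulH1Tower x Y).lim1

end Filtration

/-! Two independent facts combine. The first is about Čech homology of a limit. As `R[X]` is free on
the powers of `X`, cochains are sequences, and a coboundary is a solution of `x • φ (i + 1) - φ i =
g i` with prescribed `φ 0`. Over `Y.lim` such a solution is determined up to existence by its
diagonal, the component of `φ n` at level `n` (`exists_lim_recurrence`). On the diagonal, cocycles
become elements of lim H₁(xⁿ; Yₙ), and the obstruction to being a coboundary lies in lim¹ H₁(xⁿ;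
Yₙ). Behind this stands, for surjective systems, the picture Ȟ₁(lim Y) = lim H₁ and 0 → lim¹ H₁ →
Ȟ₀(lim Y) → lim H₀ → 0. Here H₀(xⁿ; M^(S)/Mₙ^(S)) is M^(S)/(xⁿM + Mₙ)^(S), so `cechCondition_iff`
turns the Čech condition for `S` into vanishing of lim and lim¹ for the system M^(S)/Mₙ^(S).

The second is about inverse systems. A pro-zero system has vanishing lim and lim¹, and the converse
holds once countably many copies are allowed (`ModuleTower.isProZero_of_finite_support`). Direct
sums over an infinite set and polynomial modules both supply these copies. -/

theorem PNat.eq_of_forall_succ_eq {α : Type*} {k₀ : ℕ+} (f : ∀ k, k₀ ≤ k → α)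
    (h : ∀ k hk, f (k + 1) (hk.trans (PNat.lt_add_right k 1).le) = f k hk) (k : ℕ+) (hk : k₀ ≤ k) :
    f k hk = f k₀ le_rfl := by
  induction k using PNat.recOn with
  | one =>
    obtain rfl : k₀ = 1 := le_antisymm hk one_le
    rfl
  | succ k ih =>
    rcases hk.eq_or_lt with rfl | hlt
    · rfl
    · have hk' : k₀ ≤ k := PNat.lt_add_one_iff.1 hlt
      exact (h k hk').trans (ih hk')

/-! ### Pro-zero inverse systems and the vanishing of lim and lim¹ -/

namespace ModuleTower

variable {R : Type u} [CommRing R]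

/-- A sequence compatible with the successive transition maps belongs to the limit. -/
theorem mem_lim_of_succ (Y : ModuleTower.{u, v} R) {a : ∀ n, Y.obj n}
    (h : ∀ n, Y.map (PNat.lt_add_right n 1).le (a (n + 1)) = a n) : a ∈ Y.lim := by
  intro n m hnm
  refine (PNat.eq_of_forall_succ_eq (fun k hk => Y.map hk (a k)) ?_ m hnm).trans (Y.map_refl n _)
  intro k hk
  rw [← h k, Y.map_map]

theorem subsingleton_lim1_iff (Y : ModuleTower.{u, v} R) :
    Subsingleton Y.lim1 ↔ ∀ h : ∀ n, Y.obj n, ∃ a : ∀ n, Y.obj n,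
      ∀ n, a n - Y.map (PNat.lt_add_right n 1).le (a (n + 1)) = h n := by
  rw [Submodule.Quotient.subsingleton_iff, LinearMap.range_eq_top]
  refine forall_congr' fun h => exists_congr fun a => ?_
  rw [funext_iff]
  rfl

theorem subsingleton_lim_iff (Y : ModuleTower.{u, v} R) :
    Subsingleton Y.lim ↔ ∀ a ∈ Y.lim, a = 0 := by
  rw [Submodule.subsingleton_iff_eq_bot, Submodule.eq_bot_iff]

/-- The transition map from `k` to `n`, extended by zero when `k < n`. -/
def push (Y : ModuleTower.{u, v} R) (n k : ℕ+) : Y.obj k →ₗ[R] Y.obj n :=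
  if h : n ≤ k then Y.map h else 0

theorem push_of_le (Y : ModuleTower.{u, v} R) {n k : ℕ+} (h : n ≤ k) : Y.push n k = Y.map h :=
  dif_pos h

theorem push_of_lt (Y : ModuleTower.{u, v} R) {n k : ℕ+} (h : k < n) : Y.push n k = 0 :=
  dif_neg h.not_ge

theorem push_self (Y : ModuleTower.{u, v} R) (n : ℕ+) (y : Y.obj n) : Y.push n n y = y := by
  rw [push_of_le Y le_rfl, Y.map_refl]

/-- For fixed `k`, the family `n ↦ push n k (h k)` is thus a preimage under `phi` of the family that
is `h k` in position `k` and zero elsewhere. -/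
theorem push_sub_map_push_succ (Y : ModuleTower.{u, v} R) (h : ∀ n, Y.obj n) (n k : ℕ+) :
    Y.push n k (h k) - Y.map (PNat.lt_add_right n 1).le (Y.push (n + 1) k (h k)) =
      if k = n then h n else 0 := by
  rcases lt_trichotomy k n with hlt | rfl | hgt
  · rw [push_of_lt Y hlt, push_of_lt Y (hlt.trans (PNat.lt_add_right n 1)), if_neg hlt.ne]
    simp
  · rw [push_self, push_of_lt Y (PNat.lt_add_right k 1), if_pos rfl]
    simp
  · rw [push_of_le Y hgt.le, push_of_le Y (PNat.add_one_le_iff.2 hgt), if_neg hgt.ne', Y.map_map,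
      sub_self]

namespace IsProZero

variable {Y : ModuleTower.{u, v} R}

theorem subsingleton_lim (hY : Y.IsProZero) : Subsingleton Y.lim := by
  rw [subsingleton_lim_iff]
  intro a ha
  funext n
  obtain ⟨m, h, hm⟩ := hY n
  rw [← ha n m h, hm]
  rfl

/-- Summing the solutions for all `k` gives the formal solution `a n = ∑ k, push n k (h k)`. It is a
finite sum because everything coming from levels `≥ m n` dies in level `n`. -/
theorem subsingleton_lim1 (hY : Y.IsProZero) : Subsingleton Y.lim1 := by
  rw [subsingleton_lim1_iff]
  intro h
  choose m hm hm0 using hY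
  have push_eq_zero (n k : ℕ+) (hk : m n ≤ k) : Y.push n k (h k) = 0 := by
    rw [push_of_le Y ((hm n).trans hk), ← Y.map_map (hm n) hk, hm0]
    rfl
  have sum_eq (n N : ℕ+) (hN : m n ≤ N) : ∑ k ∈ Finset.Iic (m n), Y.push n k (h k) =
      ∑ k ∈ Finset.Iic N, Y.push n k (h k) := by
    refine Finset.sum_subset (Finset.Iic_subset_Iic.2 hN) fun k _ hk => ?_
    exact push_eq_zero n k (not_le.1 fun h => hk (Finset.mem_Iic.2 h)).le
  refine ⟨fun n => ∑ k ∈ Finset.Iic (m n), Y.push n k (h k), fun n => ?_⟩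
  beta_reduce
  -- Both sums are extended to a common range so that they can be subtracted termwise.
  rw [sum_eq n _ (le_max_left (m n) (m (n + 1))), sum_eq (n + 1) _ (le_max_right (m n) (m (n + 1))),
    map_sum, ← Finset.sum_sub_distrib]
  simp_rw [push_sub_map_push_succ]
  rw [Finset.sum_ite_eq', if_pos]
  exact Finset.mem_Iic.2 ((hm n).trans (le_max_left _ _))

end IsProZero

/-- If the limit and the first derived limit vanish for an inverse system `W` which contains
countably many copies of `Z` as retracts, every element of `W` having only finitely many nonzero
components, then `Z` is pro-zero. -/
theorem isProZero_of_finite_support {Z : ModuleTower.{u, v} R} {W : ModuleTower.{u, w} R}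
    (coeff : ∀ n, ℕ+ → W.obj n →ₗ[R] Z.obj n) (single : ∀ n, ℕ+ → Z.obj n →ₗ[R] W.obj n)
    (coeff_map : ∀ (n m : ℕ+) (h : n ≤ m) (j : ℕ+) (y : W.obj m),
      coeff n j (W.map h y) = Z.map h (coeff m j y))
    (single_map : ∀ (n m : ℕ+) (h : n ≤ m) (j : ℕ+) (z : Z.obj m),
      single n j (Z.map h z) = W.map h (single m j z))
    (coeff_single : ∀ (n i j : ℕ+) (z : Z.obj n),
      coeff n j (single n i z) = if i = j then z else 0)
    (finite_support : ∀ (n : ℕ+) (y : W.obj n), {j | coeff n j y ≠ 0}.Finite)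
    (hlim : Subsingleton W.lim) (hlim1 : Subsingleton W.lim1) : Z.IsProZero := by
  have hZ : ∀ a ∈ Z.lim, a = 0 := by
    intro a ha
    rw [subsingleton_lim_iff] at hlim
    have h0 := hlim (fun n => single n 1 (a n)) fun n m h => by rw [← single_map, ha n m h]
    funext n
    have h1 := coeff_single n 1 1 (a n)
    rw [if_pos rfl, show single n 1 (a n) = 0 from congrFun h0 n, map_zero] at h1
    exact h1.symm
  by_contra hZ0
  simp only [IsProZero, not_forall, not_exists] at hZ0
  obtain ⟨n, hn⟩ := hZ0
  -- Every transition map into level `n` is nonzero, so each level above `n` has an element that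
  -- survives there; the other levels get `0`.
  have key (m : ℕ+) : ∃ z : Z.obj m, n ≤ m → Z.push n m z ≠ 0 := by
    by_cases h : n ≤ m
    · obtain ⟨z, hz⟩ := DFunLike.ne_iff.1 (hn m h)
      exact ⟨z, fun _ => by rwa [push_of_le Z h]⟩
    · exact ⟨0, fun h' => absurd h' h⟩
  choose z hz using key
  -- The `k`-th witness is placed in the `k`-th copy of `Z`, so that different witnesses do not
  -- interfere.
  obtain ⟨a, ha⟩ := (subsingleton_lim1_iff W).1 hlim1 fun k => single k k (z k)
  -- In copy `j` both families solve the `phi` equation with right-hand side `z j` in position `j`.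
  -- Their difference lies in the limit of `Z`, which is zero.
  have hcoeff (j : ℕ+) : (fun k => coeff k j (a k) - Z.push k j (z j)) = 0 := by
    refine hZ _ (mem_lim_of_succ Z fun k => ?_)
    have h1 := congrArg (coeff k j) (ha k)
    rw [map_sub, coeff_map, coeff_single, sub_eq_iff_eq_add] at h1
    have h2 := push_sub_map_push_succ Z (Pi.single j (z j)) k j
    rw [Pi.single_eq_same, sub_eq_iff_eq_add] at h2
    rw [h1, h2, map_sub]
    by_cases hkj : k = j
    · subst hkj
      simp
    · rw [if_neg hkj, if_neg (Ne.symm hkj), zero_add, zero_add]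
  -- Hence `a n` has a nonzero component in every copy beyond `n`, against finite support.
  refine (Set.infinite_of_injective_forall_mem (f := fun i : ℕ+ => n + i)
    (s := {j | coeff n j (a n) ≠ 0}) (fun _ _ => add_left_cancel) fun i => ?_) (finite_support n _)
  have h1 := congrFun (hcoeff (n + i)) n
  rw [Set.mem_ofPred_eq, sub_eq_zero.1 h1]
  exact hz _ (PNat.lt_add_right n i).le

end ModuleTower

/-! ### The Koszul system in terms of elements -/

section KoszulTower

variable {R : Type u} [CommRing R] (x : R) (Y : ModuleTower.{u, v} R)

theorem koszulH1Tower_map_coe {n m : ℕ+} (h : n ≤ m) (y : (koszulH1Tower x Y).obj m) :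
    ((koszulH1Tower x Y).map h y).1 = x ^ ((m : ℕ) - n) • Y.map h y.1 :=
  rfl

theorem koszulH1Tower_map_succ_coe (n : ℕ+) (y : (koszulH1Tower x Y).obj (n + 1)) :
    ((koszulH1Tower x Y).map (PNat.lt_add_right n 1).le y).1 =
      x • Y.map (PNat.lt_add_right n 1).le y.1 := by
  have h : ((n + 1 : ℕ+) : ℕ) - n = 1 := Nat.add_sub_cancel_left _ _
  exact (congrArg (fun k => x ^ k • Y.map _ y.1) h).trans (by rw [pow_one])

theorem isProZero_koszulH1Tower_iff :
    (koszulH1Tower x Y).IsProZero ↔ ∀ n : ℕ+, ∃ (m : ℕ+) (h : n ≤ m), ∀ y : Y.obj m,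
      x ^ (m : ℕ) • y = 0 → x ^ ((m : ℕ) - n) • Y.map h y = 0 := by
  refine forall_congr' fun n => exists_congr fun m => exists_congr fun h => ?_
  constructor
  · intro h0 y hy
    exact congrArg Subtype.val (LinearMap.congr_fun h0 ⟨y, hy⟩)
  · intro h0
    exact LinearMap.ext fun y => Subtype.ext (h0 y.1 y.2)

theorem subsingleton_lim_koszulH1Tower_iff :
    Subsingleton (koszulH1Tower x Y).lim ↔ ∀ y : ∀ n, Y.obj n, (∀ n : ℕ+, x ^ (n : ℕ) • y n = 0) →
      (∀ n, x • Y.map (PNat.lt_add_right n 1).le (y (n + 1)) = y n) → y = 0 := by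
  rw [ModuleTower.subsingleton_lim_iff]
  constructor
  · intro h y hy hyx
    have h0 := h (fun n => ⟨y n, hy n⟩) (ModuleTower.mem_lim_of_succ _ fun n =>
      Subtype.ext ((koszulH1Tower_map_succ_coe x Y n _).trans (hyx n)))
    funext n
    exact congrArg Subtype.val (congrFun h0 n)
  · intro h a ha
    have h0 := h (fun n => (a n).1) (fun n => (a n).2) fun n => by
      rw [← koszulH1Tower_map_succ_coe, ha]
    funext n
    exact Subtype.ext (congrFun h0 n)

theorem subsingleton_lim1_koszulH1Tower_iff :
    Subsingleton (koszulH1Tower x Y).lim1 ↔ ∀ h : ∀ n, Y.obj n,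
      (∀ n : ℕ+, x ^ (n : ℕ) • h n = 0) → ∃ a : ∀ n, Y.obj n, (∀ n : ℕ+, x ^ (n : ℕ) • a n = 0) ∧
        ∀ n, a n - x • Y.map (PNat.lt_add_right n 1).le (a (n + 1)) = h n := by
  rw [ModuleTower.subsingleton_lim1_iff]
  constructor
  · intro H h hh
    obtain ⟨a, ha⟩ := H fun n => ⟨h n, hh n⟩
    refine ⟨fun n => (a n).1, fun n => (a n).2, fun n => ?_⟩
    rw [← koszulH1Tower_map_succ_coe]
    exact congrArg Subtype.val (ha n)
  · intro H h
    obtain ⟨a, ha, hah⟩ := H (fun n => (h n).1) fun n => (h n).2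
    refine ⟨fun n => ⟨a n, ha n⟩, fun n => Subtype.ext ?_⟩
    rw [← hah n, ← koszulH1Tower_map_succ_coe x Y n ⟨a (n + 1), ha (n + 1)⟩]
    rfl

variable {x Y} in
theorem ModuleTower.IsProZero.koszulLimVanish (h : (koszulH1Tower x Y).IsProZero) :
    KoszulLimVanish x Y :=
  ⟨h.subsingleton_lim, h.subsingleton_lim1⟩

/-- The map `H₁(a; N) → H₁(a; N')` induced by a linear map `N → N'`. -/
def koszulH1Map (a : R) {N : Type v} {N' : Type w} [AddCommGroup N] [Module R N]
    [AddCommGroup N'] [Module R N'] (f : N →ₗ[R] N') : koszulH1 a N →ₗ[R] koszulH1 a N' :=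
  f.restrict fun y hy => by
    have hy' : a • y = 0 := hy
    change a • f y = 0
    rw [← map_smul, hy', map_zero]

/-- Retractions and inclusions commute with powers of `x`, so they restrict to the Koszul kernels.
-/
theorem isProZero_koszulH1Tower_of_finite_support {Z : ModuleTower.{u, v} R}
    {W : ModuleTower.{u, w} R}
    (coeff : ∀ n, ℕ+ → W.obj n →ₗ[R] Z.obj n) (single : ∀ n, ℕ+ → Z.obj n →ₗ[R] W.obj n)
    (coeff_map : ∀ (n m : ℕ+) (h : n ≤ m) (j : ℕ+) (y : W.obj m),
      coeff n j (W.map h y) = Z.map h (coeff m j y))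
    (single_map : ∀ (n m : ℕ+) (h : n ≤ m) (j : ℕ+) (z : Z.obj m),
      single n j (Z.map h z) = W.map h (single m j z))
    (coeff_single : ∀ (n i j : ℕ+) (z : Z.obj n),
      coeff n j (single n i z) = if i = j then z else 0)
    (finite_support : ∀ (n : ℕ+) (y : W.obj n), {j | coeff n j y ≠ 0}.Finite)
    (h : KoszulLimVanish x W) : (koszulH1Tower x Z).IsProZero := by
  refine ModuleTower.isProZero_of_finite_support (W := koszulH1Tower x W)
    (fun n j => koszulH1Map _ (coeff n j)) (fun n j => koszulH1Map _ (single n j))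
    ?_ ?_ ?_ ?_ h.1 h.2
  · intro n m h j y
    apply Subtype.ext
    rw [koszulH1Tower_map_coe]
    change coeff n j (x ^ ((m : ℕ) - n) • W.map h y.1) = _
    rw [map_smul, coeff_map]
    rfl
  · intro n m h j z
    apply Subtype.ext
    rw [koszulH1Tower_map_coe]
    change single n j (x ^ ((m : ℕ) - n) • Z.map h z.1) = _
    rw [map_smul, single_map]
    rfl
  · intro n i j z
    apply Subtype.ext
    refine (coeff_single n i j z.1).trans ?_
    split_ifs <;> rfl
  · intro n y
    refine (finite_support n y.1).subset fun j hj h0 => hj (Subtype.ext h0)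

end KoszulTower

/-! ### Čech cochains as sequences -/

section CechSequences

variable {R : Type u} [CommRing R] (x : R) {N : Type v} [AddCommGroup N] [Module R N]

theorem Polynomial.exists_linearMap_X_pow (a : ℕ → N) : ∃ f : R[X] →ₗ[R] N, ∀ i, f (X ^ i) = a i := by
  refine ⟨(Polynomial.basisMonomials R).constr R a, fun i => ?_⟩
  rw [← monomial_one_right_eq_X_pow, ← congrFun (Polynomial.coe_basisMonomials (R := R)) i,
    Module.Basis.constr_basis]

theorem Polynomial.linearMap_ext_X_pow {f g : R[X] →ₗ[R] N} (h : ∀ i, f (X ^ i) = g (X ^ i)) :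
    f = g := by
  refine Polynomial.lhom_ext' fun i => LinearMap.ext_ring ?_
  simpa [monomial_one_right_eq_X_pow] using h i

theorem exists_cech_cochain (b : N) (a : ℕ → N) :
    ∃ g : (R[X] × R) →ₗ[R] N, g (0, 1) = b ∧ ∀ i, g (X ^ i, 0) = a i := by
  obtain ⟨f, hf⟩ := Polynomial.exists_linearMap_X_pow (R := R) a
  refine ⟨f.coprod (LinearMap.toSpanSingleton R N b), ?_, fun i => ?_⟩ <;> simp [hf]

theorem cech_cochain_ext {f g : (R[X] × R) →ₗ[R] N} (h1 : f (0, 1) = g (0, 1))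
    (h2 : ∀ i, f (X ^ i, 0) = g (X ^ i, 0)) : f = g := by
  refine LinearMap.prod_ext (Polynomial.linearMap_ext_X_pow h2) (LinearMap.ext_ring h1)

theorem apply_koszulToCech (g : (R[X] × R) →ₗ[R] N) (n : ℕ) :
    g (koszulToCech x n) = g (0, 1) + ∑ i ∈ Finset.range n, x ^ i • g (X ^ i, 0) := by
  have h : koszulToCech x n =
      (0, 1) + ∑ i ∈ Finset.range n, x ^ i • ((X ^ i, 0) : R[X] × R) := by
    ext1
    · simp [koszulToCech, Prod.fst_sum, mul_pow, smul_eq_C_mul]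
    · simp [koszulToCech, Prod.snd_sum]
  rw [h, map_add, map_sum]
  simp_rw [map_smul]

theorem cechDifferential_apply_zero_one (φ : R[X] →ₗ[R] N) :
    cechDifferential x N φ (0, 1) = φ (X ^ 0) := by
  simp [cechResolution]

theorem cechDifferential_apply_X_pow (φ : R[X] →ₗ[R] N) (i : ℕ) :
    cechDifferential x N φ (X ^ i, 0) = x • φ (X ^ (i + 1)) - φ (X ^ i) := by
  have h : cechResolution x (X ^ i, 0) = x • X ^ (i + 1) - X ^ i := by
    simp only [cechResolution, LinearMap.sub_apply, LinearMap.comp_apply, LinearMap.snd_apply,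
      LinearMap.fst_apply, LinearMap.mulLeft_apply, map_zero, smul_eq_C_mul]
    ring
  rw [LinearMap.lcomp_apply, h, map_sub, map_smul]

theorem mem_range_cechDifferential_iff (g : (R[X] × R) →ₗ[R] N) :
    g ∈ LinearMap.range (cechDifferential x N) ↔
      ∃ φ : ℕ → N, φ 0 = g (0, 1) ∧ ∀ i, x • φ (i + 1) - φ i = g (X ^ i, 0) := by
  constructor
  · rintro ⟨φ, rfl⟩
    exact ⟨fun i => φ (X ^ i), (cechDifferential_apply_zero_one x φ).symm,
      fun i => (cechDifferential_apply_X_pow x φ i).symm⟩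
  · rintro ⟨φ, h0, h1⟩
    obtain ⟨f, hf⟩ := Polynomial.exists_linearMap_X_pow (R := R) φ
    refine ⟨f, cech_cochain_ext ?_ fun i => ?_⟩
    · rw [cechDifferential_apply_zero_one, hf, h0]
    · rw [cechDifferential_apply_X_pow, hf, hf, h1]

/-- The class in `Ȟ₀ˣ(N)` of a Čech cochain. -/
noncomputable def cechH0Mk (N : Type v) [AddCommGroup N] [Module R N] :
    ((R[X] × R) →ₗ[R] N) →ₗ[R] cechH0 x N :=
  Submodule.mkQ _

theorem cechH0Mk_surjective : Function.Surjective (cechH0Mk x N) :=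
  Submodule.mkQ_surjective _

theorem cechH0Mk_eq_zero_iff (g : (R[X] × R) →ₗ[R] N) :
    cechH0Mk x N g = 0 ↔ g ∈ LinearMap.range (cechDifferential x N) :=
  Submodule.Quotient.mk_eq_zero _

theorem subsingleton_cechH1_iff :
    Subsingleton (cechH1 x N) ↔
      ∀ φ : ℕ → N, φ 0 = 0 → (∀ i, x • φ (i + 1) - φ i = 0) → φ = 0 := by
  rw [Submodule.subsingleton_iff_eq_bot, Submodule.eq_bot_iff]
  constructor
  · intro h φ h0 h1
    obtain ⟨f, hf⟩ := Polynomial.exists_linearMap_X_pow (R := R) φ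
    have hf0 := h f <| LinearMap.mem_ker.2 <| cech_cochain_ext
      (by rw [cechDifferential_apply_zero_one, hf, h0, LinearMap.zero_apply])
      fun i => by rw [cechDifferential_apply_X_pow, hf, hf, h1, LinearMap.zero_apply]
    funext i
    rw [← hf, hf0]
    rfl
  · intro h f hf
    rw [LinearMap.mem_ker] at hf
    have h0 := h (fun i => f (X ^ i))
      (by rw [← cechDifferential_apply_zero_one x, hf, LinearMap.zero_apply])
      fun i => by rw [← cechDifferential_apply_X_pow, hf, LinearMap.zero_apply]
    exact Polynomial.linearMap_ext_X_pow fun i => congrFun h0 i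

-- Iterating `φ i = x • φ (i + 1) - a i`. By `apply_koszulToCech`, the right-hand side is the value
-- on `koszulToCech x n` of the cochain with coefficients `φ 0` and `a`.
variable {x} in
theorem pow_smul_eq_add_sum {φ a : ℕ → N} (h : ∀ i, x • φ (i + 1) - φ i = a i) (n : ℕ) :
    x ^ n • φ n = φ 0 + ∑ i ∈ Finset.range n, x ^ i • a i := by
  induction n with
  | zero => simp
  | succ n ih =>
    rw [Finset.sum_range_succ, ← add_assoc, ← ih, ← h n, smul_sub, add_sub_cancel, smul_smul,
      ← pow_succ]

end CechSequences

/-! ### Čech homology of an inverse limit -/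

section CechLimit

variable {R : Type u} [CommRing R] (x : R) (Y : ModuleTower.{u, v} R)

/-- A system of recurrence relations over the limit can be solved when it can be solved along the
diagonal. -/
theorem exists_lim_recurrence (g : ℕ → Y.lim) (y : ∀ n, Y.obj n)
    (hy : ∀ n : ℕ+, x • Y.map (PNat.lt_add_right n 1).le (y (n + 1)) = y n + (g n).1 n) :
    ∃ φ : ℕ → Y.lim, (∀ i, x • φ (i + 1) - φ i = g i) ∧ ∀ n : ℕ+, (φ n).1 n = y n := by
  -- Unrolling the recurrence from `i` up to `k` and putting `y k` for `φ k` forces this value at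
  -- level `m`. It does not depend on `k` once `k ≥ i` and `k ≥ m`; `K i m` is such a `k`.
  let c (i : ℕ) (m k : ℕ+) : Y.obj m := x ^ ((k : ℕ) - i) • Y.push m k (y k) -
    ∑ j ∈ Finset.Ico i k, x ^ (j - i) • (g j).1 m
  have c_succ (i : ℕ) (m k : ℕ+) (hi : i ≤ k) (hm : m ≤ k) : c i m (k + 1) = c i m k := by
    have h1 : Y.push m (k + 1) (y (k + 1)) =
        Y.map hm (Y.map (PNat.lt_add_right k 1).le (y (k + 1))) := by
      rw [Y.push_of_le (hm.trans (PNat.lt_add_right k 1).le), Y.map_map]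
    have h2 : ((k + 1 : ℕ+) : ℕ) - i = ((k : ℕ) - i) + 1 := by
      rw [PNat.add_coe, PNat.one_coe, Nat.sub_add_comm hi]
    simp only [c]
    rw [h2, pow_succ, mul_smul, h1, ← map_smul, hy, map_add, (g k).2 m k hm, PNat.add_coe,
      PNat.one_coe, Finset.sum_Ico_succ_top hi, Y.push_of_le hm, smul_add]
    abel
  have c_eq (i : ℕ) (m k k' : ℕ+) (hi : i ≤ k) (hm : m ≤ k) (hk : k ≤ k') :
      c i m k' = c i m k :=
    PNat.eq_of_forall_succ_eq (fun k' _ => c i m k')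
      (fun k' h => c_succ i m k' (hi.trans h) (hm.trans h)) k' hk
  have map_c (i : ℕ) (n m k : ℕ+) (hn : n ≤ m) (hm : m ≤ k) : Y.map hn (c i m k) = c i n k := by
    simp only [c]
    rw [map_sub, map_smul, map_sum, Y.push_of_le hm, Y.push_of_le (hn.trans hm), Y.map_map]
    congr 1
    exact Finset.sum_congr rfl fun j _ => by rw [map_smul, (g j).2 n m hn]
  let K (i : ℕ) (m : ℕ+) : ℕ+ := ⟨m + i, Nat.add_pos_left m.pos i⟩
  have hiK (i : ℕ) (m : ℕ+) : i ≤ K i m := Nat.le_add_left i m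
  have hmK (i : ℕ) (m : ℕ+) : m ≤ K i m := Nat.le_add_right (m : ℕ) i
  refine ⟨fun i => ⟨fun m => c i m (K i m), fun n m h => ?_⟩, fun i => ?_, fun n => ?_⟩
  · rw [map_c i n m _ h (hmK i m)]
    exact c_eq i n _ _ (hiK i n) (hmK i n) (Nat.add_le_add_right (show (n : ℕ) ≤ m from h) i)
  · apply Subtype.ext
    funext m
    change x • c (i + 1) m (K (i + 1) m) - c i m (K i m) = (g i).1 m
    have hik : i + 1 ≤ (K (i + 1) m : ℕ) := hiK (i + 1) m
    -- Both terms are computed with the same upper index, after which the sums differ only in the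
    -- term `j = i`.
    rw [← c_eq i m (K i m) (K (i + 1) m) (hiK i m) (hmK i m) (Nat.le_succ _)]
    have h2 : ((K (i + 1) m : ℕ+) : ℕ) - i = (K (i + 1) m : ℕ) - (i + 1) + 1 := by omega
    simp only [c]
    rw [smul_sub, smul_smul, ← pow_succ', ← h2, Finset.sum_eq_sum_Ico_succ_bot hik,
      Finset.smul_sum, Nat.sub_self, pow_zero, one_smul]
    have h3 : ∑ j ∈ Finset.Ico (i + 1) (K (i + 1) m), x • x ^ (j - (i + 1)) • (g j).1 m =
        ∑ j ∈ Finset.Ico (i + 1) (K (i + 1) m), x ^ (j - i) • (g j).1 m := by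
      refine Finset.sum_congr rfl fun j hj => ?_
      have hj' : j - i = j - (i + 1) + 1 := by
        have := (Finset.mem_Ico.1 hj).1
        omega
      rw [smul_smul, ← pow_succ', ← hj']
    rw [h3]
    abel
  · change c n n (K n n) = y n
    rw [c_eq n n n (K n n) le_rfl le_rfl (hmK n n)]
    simp [c, Y.push_self]

/-- Series in the limit whose `n`-th term vanishes at the `n`-th level converge. -/
theorem exists_lim_sum (e : ℕ → Y.lim) (he : ∀ n : ℕ+, (e n).1 n = 0) :
    ∃ s : Y.lim, ∀ n : ℕ+, s.1 n = ∑ i ∈ Finset.range n, (e i).1 n := by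
  refine ⟨⟨fun n => ∑ i ∈ Finset.range n, (e i).1 n, fun n m h => ?_⟩, fun n => rfl⟩
  rw [map_sum]
  simp_rw [(e _).2 n m h]
  refine (Finset.sum_subset (Finset.range_subset_range.2 (show (n : ℕ) ≤ m from h))
    fun i _ hi => ?_).symm
  have hi' : (n : ℕ) ≤ i := not_lt.1 fun h => hi (Finset.mem_range.2 h)
  lift i to ℕ+ using n.pos.trans_le hi'
  rw [← (e i).2 n i hi', he, map_zero]

/-- A cocycle `φ` corresponds to its diagonal. Since `φ 0 = xⁿ • φ n`, the condition `φ 0 = 0` says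
that the diagonal entry at level `n` is killed by `xⁿ`. -/
theorem subsingleton_cechH1_lim_iff :
    Subsingleton (cechH1 x Y.lim) ↔ Subsingleton (koszulH1Tower x Y).lim := by
  rw [subsingleton_cechH1_iff, subsingleton_lim_koszulH1Tower_iff]
  constructor
  · intro H y hy hyx
    obtain ⟨φ, hφ, hφy⟩ := exists_lim_recurrence x Y 0 y fun n => by simp [hyx n]
    have hφ0 : φ 0 = 0 := by
      apply Subtype.ext
      funext n
      have h1 := congrArg (fun z : Y.lim => z.1 n) (pow_smul_eq_add_sum hφ n)
      have h2 : x ^ (n : ℕ) • (φ n).1 n = (φ 0).1 n := by simpa using h1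
      rw [← h2, hφy, hy]
      rfl
    funext n
    rw [← hφy, H φ hφ0 hφ]
    rfl
  · intro H φ h0 h1
    have hpow (i k : ℕ) : φ i = x ^ k • φ (i + k) := by
      induction k with
      | zero => simp
      | succ k ih => rw [ih, pow_succ, mul_smul, ← sub_eq_zero.1 (h1 (i + k)), add_assoc]
    have hdiag := H (fun n => (φ n).1 n)
      (fun n => by
        have h2 := hpow 0 n
        rw [h0, zero_add] at h2
        exact (congrArg (fun z : Y.lim => z.1 n) h2).symm)
      fun n => by
        rw [(φ _).2]
        exact congrArg (fun z : Y.lim => z.1 n) (sub_eq_zero.1 (h1 n))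
    funext i
    apply Subtype.ext
    funext m
    -- Component `m` of `φ i` is `x ^ m` times that of `φ (i + m)`, which is the image of a diagonal
    -- entry at level `i + m`.
    obtain ⟨k, hk⟩ : ∃ k : ℕ+, (k : ℕ) = i + m := ⟨⟨i + m, Nat.add_pos_right i m.pos⟩, rfl⟩
    have h3 : m ≤ k := (Nat.le_add_left (m : ℕ) i).trans hk.ge
    have h4 : (φ (i + m)).1 k = 0 := hk ▸ congrFun hdiag k
    rw [hpow i m]
    change x ^ (m : ℕ) • (φ (i + m)).1 m = 0
    rw [← (φ (i + m)).2 m k h3, h4, map_zero, smul_zero]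

theorem lim_apply_koszulToCech (g : (R[X] × R) →ₗ[R] Y.lim) (k : ℕ) (n : ℕ+) :
    (g (koszulToCech x k)).1 n =
      (g (0, 1)).1 n + ∑ i ∈ Finset.range k, x ^ i • (g (X ^ i, 0)).1 n := by
  rw [apply_koszulToCech]
  simp

/-- If the first derived limit of the Koszul homology modules vanishes, then a Čech cochain with
values in the limit whose images in Koszul homology of degree `0` vanish is a coboundary. -/
theorem mem_range_cechDifferential_of_lim1 (h1 : Subsingleton (koszulH1Tower x Y).lim1)
    (g : (R[X] × R) →ₗ[R] Y.lim)
    (hg : ∀ n : ℕ+, ∃ y : Y.obj n, (g (koszulToCech x n)).1 n = x ^ (n : ℕ) • y) :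
    g ∈ LinearMap.range (cechDifferential x Y.lim) := by
  choose y hy using hg
  rw [subsingleton_lim1_koszulH1Tower_iff] at h1
  -- The quotients `y n` satisfy the diagonal recurrence only up to an error killed by `xⁿ`.
  -- Subtracting `a n` removes the error and leaves `xⁿ • y n` unchanged, which later gives the
  -- right `φ 0`.
  obtain ⟨a, ha, hah⟩ := h1
    (fun n => y n + (g (X ^ (n : ℕ), 0)).1 n - x • Y.map (PNat.lt_add_right n 1).le (y (n + 1)))
    fun n => by
      have h2 := (g (koszulToCech x (n + 1 : ℕ+))).2 n (n + 1) (PNat.lt_add_right n 1).le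
      rw [hy, lim_apply_koszulToCech, PNat.add_coe, PNat.one_coe, Finset.sum_range_succ,
        ← add_assoc, ← lim_apply_koszulToCech, hy, map_smul, pow_succ, mul_smul] at h2
      rw [smul_sub, smul_add, h2, sub_self]
  obtain ⟨φ, hφ, hφy⟩ := exists_lim_recurrence x Y (fun i => g (X ^ i, 0)) (fun n => y n - a n)
    fun n => by
      have h2 := hah n
      rw [map_sub, smul_sub]
      rw [sub_eq_sub_iff_add_eq_add] at h2
      rw [sub_eq_iff_eq_add, sub_add_eq_add_sub, sub_add_eq_add_sub, eq_sub_iff_add_eq, add_comm, h2]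
  refine (mem_range_cechDifferential_iff x g).2 ⟨φ, ?_, hφ⟩
  apply Subtype.ext
  funext n
  have h2 := congrArg (fun z : Y.lim => z.1 n) (pow_smul_eq_add_sum hφ n)
  have h3 : x ^ (n : ℕ) • (φ n).1 n =
    (φ 0).1 n + ∑ i ∈ Finset.range n, x ^ i • (g (X ^ i, 0)).1 n := by simpa using h2
  rw [hφy, smul_sub, ha, sub_zero, ← hy, lim_apply_koszulToCech] at h3
  exact (add_right_cancel h3).symm

/-- Converse of `mem_range_cechDifferential_of_lim1`. -/
theorem subsingleton_lim1_of_mem_range_cechDifferential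
    (hY : ∀ n, Function.Surjective (Y.limProj n))
    (H : ∀ g : (R[X] × R) →ₗ[R] Y.lim,
      (∀ n : ℕ+, ∃ y : Y.obj n, (g (koszulToCech x n)).1 n = x ^ (n : ℕ) • y) →
        g ∈ LinearMap.range (cechDifferential x Y.lim)) :
    Subsingleton (koszulH1Tower x Y).lim1 := by
  rw [subsingleton_lim1_koszulH1Tower_iff]
  intro h hh
  have hlift (i : ℕ) : ∃ b : Y.lim, ∀ n : ℕ+, (n : ℕ) = i → b.1 n = h n := by
    rcases Nat.eq_zero_or_pos i with rfl | hi
    · exact ⟨0, fun n hn => absurd hn n.ne_zero⟩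
    · obtain ⟨b, hb⟩ := hY ⟨i, hi⟩ (h ⟨i, hi⟩)
      refine ⟨b, fun n hn => ?_⟩
      obtain rfl : n = ⟨i, hi⟩ := PNat.eq hn
      exact hb
  choose b hb using hlift
  -- The series `∑ xⁱ bᵢ` converges because `xⁿ • h n = 0`. Using `-s` as constant part makes the
  -- cochain below vanish in every Koszul H₀, and the negated diagonal of a solution `φ` then solves
  -- the lim¹ equation for `h`.
  obtain ⟨s, hs⟩ := exists_lim_sum Y (fun i => x ^ i • b i) fun n => by
    change x ^ (n : ℕ) • (b n).1 n = 0
    rw [hb n n rfl, hh]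
  obtain ⟨g, hg0, hg⟩ := exists_cech_cochain (R := R) (-s) b
  have hgk (n : ℕ+) : (g (koszulToCech x n)).1 n = 0 := by
    rw [lim_apply_koszulToCech, hg0]
    simp_rw [hg]
    change -s.1 n + _ = 0
    rw [hs]
    exact neg_add_cancel _
  obtain ⟨φ, hφ0, hφ⟩ := (mem_range_cechDifferential_iff x g).1
    (H g fun n => ⟨0, by rw [hgk, smul_zero]⟩)
  refine ⟨fun n => -(φ n).1 n, fun n => ?_, fun n => ?_⟩
  · have h2 := congrArg (fun z : Y.lim => z.1 n) (pow_smul_eq_add_sum hφ n)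
    rw [hφ0, ← apply_koszulToCech] at h2
    rw [smul_neg, neg_eq_zero, ← hgk n, ← h2]
    rfl
  · have h2 := congrArg (fun z : Y.lim => z.1 n) ((hφ n).trans (hg n))
    rw [← hb n n rfl, ← h2, map_neg, (φ _).2]
    change -(φ n).1 n - x • -(φ (n + 1)).1 n = x • (φ (n + 1)).1 n - (φ n).1 n
    rw [smul_neg]
    abel

/-- A family which is compatible modulo the powers of `x` comes from a Čech cochain. -/
theorem exists_cech_cochain_of_compatible (hY : ∀ n, Function.Surjective (Y.limProj n))
    (c : ∀ n, Y.obj n)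
    (hc : ∀ n : ℕ+, ∃ w : Y.obj n,
      Y.map (PNat.lt_add_right n 1).le (c (n + 1)) = c n + x ^ (n : ℕ) • w) :
    ∃ g : (R[X] × R) →ₗ[R] Y.lim, ∀ n : ℕ+, (g (koszulToCech x n)).1 n = c n := by
  choose w hw using hc
  choose z hz using fun n => hY n (c n)
  choose w' hw' using fun n => hY n (w n)
  -- Index `0` carries no datum; the value `zs 0 = 0` makes the sum of the `zs (i + 1) - zs i` over
  -- `i < n` equal to `zs n`.
  let ww (i : ℕ) : Y.lim := if h : 0 < i then w' ⟨i, h⟩ else 0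
  let zs (i : ℕ) : Y.lim := if h : 0 < i then z ⟨i, h⟩ else 0
  have hzs (n : ℕ+) : zs n = z n := dif_pos n.pos
  have hww (n : ℕ+) : ww n = w' n := dif_pos n.pos
  -- The terms vanish on the diagonal by compatibility of `c`. Adding back `∑ xⁱ wwᵢ` in
  -- `koszulToCech` leaves a telescoping sum.
  obtain ⟨s, hs⟩ := exists_lim_sum Y (fun i => zs (i + 1) - zs i - x ^ i • ww i) fun n => by
    have h2 : zs ((n : ℕ) + 1) = z (n + 1) := hzs (n + 1)
    rw [h2, hzs, hww]
    change (z (n + 1)).1 n - (z n).1 n - x ^ (n : ℕ) • (w' n).1 n = 0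
    have h3 : (z n).1 n = c n := hz n
    have h4 : (w' n).1 n = w n := hw' n
    have h5 : (z (n + 1)).1 (n + 1) = c (n + 1) := hz (n + 1)
    rw [h3, h4, ← (z (n + 1)).2 n (n + 1) (PNat.lt_add_right n 1).le, h5, hw]
    abel
  obtain ⟨g, hg0, hg⟩ := exists_cech_cochain (R := R) s ww
  refine ⟨g, fun n => ?_⟩
  rw [lim_apply_koszulToCech, hg0, hs, ← Finset.sum_add_distrib]
  simp_rw [hg]
  have h2 (i : ℕ) : (zs (i + 1) - zs i - x ^ i • ww i).1 n + x ^ i • (ww i).1 n =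
      (zs (i + 1)).1 n - (zs i).1 n :=
    sub_add_cancel _ _
  simp_rw [h2]
  rw [Finset.sum_range_sub (fun i => (zs i).1 n), hzs]
  have h3 : (z n).1 n = c n := hz n
  rw [h3]
  exact sub_zero _

end CechLimit

/-! ### Application to the filtrations Mₙ^(S) and to polynomial modules -/

section Filtration

variable {R : Type u} [CommRing R] {M : Type v} [AddCommGroup M] [Module R M]
  (x : R) (F : ℕ+ → Submodule R M) (hF : Antitone F) (S : Type w)

theorem limProj_quotientTower_surjective (n : ℕ+) :
    Function.Surjective ((quotientTower F hF).limProj n) := by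
  intro z
  obtain ⟨y, rfl⟩ := Submodule.Quotient.mk_surjective _ z
  exact ⟨⟨fun _ => Submodule.Quotient.mk y, fun _ _ _ => rfl⟩, rfl⟩

theorem exists_sub_pow_smul_mem_directSumFiltration {n : ℕ+} {f : S →₀ M}
    (hf : f ∈ directSumFiltration S (inducedFiltration x F) n) :
    ∃ g : S →₀ M, f - x ^ (n : ℕ) • g ∈ directSumFiltration S F n := by
  -- The choice must send `0` to `0` so that applying it coordinatewise preserves finite support.
  have key (m : M) : ∃ y : M, (m = 0 → y = 0) ∧
      (m ∈ inducedFiltration x F n → m - x ^ (n : ℕ) • y ∈ F n) := by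
    rcases eq_or_ne m 0 with rfl | hm
    · exact ⟨0, fun _ => rfl, fun _ => by simp⟩
    by_cases h : m ∈ inducedFiltration x F n
    · obtain ⟨_, ⟨y, rfl⟩, z, hz, rfl⟩ := Submodule.mem_sup.1 h
      exact ⟨y, fun h => absurd h hm, fun _ => by simpa using hz⟩
    · exact ⟨0, fun _ => rfl, fun h' => absurd h' h⟩
  choose y hy0 hy using key
  exact ⟨f.mapRange y (hy0 0 rfl), fun s => by simpa using hy _ (hf s)⟩

/-- This identifies the target with H₀(xⁿ; M^(S)/Mₙ^(S)), matching the divisibility hypothesis of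
`mem_range_cechDifferential_of_lim1`. -/
theorem factor_directSumFiltration_eq_zero_iff {n : ℕ+} (z : (S →₀ M) ⧸ directSumFiltration S F n) :
    Submodule.factor (directSumFiltration_le_induced x F S n) z = 0 ↔
      ∃ y, z = x ^ (n : ℕ) • y := by
  constructor
  · obtain ⟨f, rfl⟩ := Submodule.Quotient.mk_surjective _ z
    intro hf
    obtain ⟨g, hg⟩ := exists_sub_pow_smul_mem_directSumFiltration x F S
      ((Submodule.Quotient.mk_eq_zero _).1 hf)
    exact ⟨Submodule.Quotient.mk g, (Submodule.Quotient.eq _).2 hg⟩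
  · rintro ⟨y, rfl⟩
    rw [map_smul, pow_smul_quotient_induced]

theorem cechToInducedCompletion_mk_coe (g : (R[X] × R) →ₗ[R] completion F hF S) (n : ℕ+) :
    (cechToInducedCompletion x F hF S (cechH0Mk x _ g)).1 n =
      Submodule.factor (directSumFiltration_le_induced x F S n) ((g (koszulToCech x n)).1 n) :=
  rfl

theorem cechToInducedCompletion_mk_eq_zero_iff (g : (R[X] × R) →ₗ[R] completion F hF S) :
    cechToInducedCompletion x F hF S (cechH0Mk x _ g) = 0 ↔
      ∀ n : ℕ+, ∃ y, (g (koszulToCech x n)).1 n = x ^ (n : ℕ) • y := by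
  rw [Subtype.ext_iff, funext_iff]
  refine forall_congr' fun n => ?_
  rw [cechToInducedCompletion_mk_coe]
  exact factor_directSumFiltration_eq_zero_iff x F S _

/-- Lifts to M^(S) of a compatible family agree modulo Mₙ^(S) up to multiples of `xⁿ`, which is all
that `exists_cech_cochain_of_compatible` needs. -/
theorem cechToInducedCompletion_surjective :
    Function.Surjective (cechToInducedCompletion x F hF S) := by
  intro b
  choose z hz using fun n => Submodule.Quotient.mk_surjective _ (b.1 n)
  obtain ⟨g, hg⟩ := exists_cech_cochain_of_compatible x
    (quotientTower (directSumFiltration S F) (directSumFiltration_antitone S hF))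
    (limProj_quotientTower_surjective _ _) (fun n => Submodule.Quotient.mk (z n)) fun n => by
      have h1 := b.2 n (n + 1) (PNat.lt_add_right n 1).le
      rw [← hz, ← hz] at h1
      obtain ⟨y, hy⟩ := exists_sub_pow_smul_mem_directSumFiltration x F S
        ((Submodule.Quotient.eq _).1 h1)
      refine ⟨Submodule.Quotient.mk y, (Submodule.Quotient.eq _).2 ?_⟩
      rwa [← sub_sub]
  refine ⟨cechH0Mk x _ g, Subtype.ext (funext fun n => ?_)⟩
  rw [cechToInducedCompletion_mk_coe, hg, ← hz]
  rfl

/-- Surjectivity being automatic, bijectivity amounts to injectivity, which the two lim¹ lemmas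
translate. -/
theorem cechCondition_iff :
    CechCondition x F hF S ↔ KoszulLimVanish x
      (quotientTower (directSumFiltration S F) (directSumFiltration_antitone S hF)) := by
  refine and_congr (subsingleton_cechH1_lim_iff x _) ?_
  rw [Function.Bijective, and_iff_left (cechToInducedCompletion_surjective x F hF S),
    injective_iff_map_eq_zero]
  constructor
  · intro h
    refine subsingleton_lim1_of_mem_range_cechDifferential x _
      (limProj_quotientTower_surjective _ _) fun g hg => ?_
    refine (cechH0Mk_eq_zero_iff x g).1 (h _ ?_)
    exact ((cechToInducedCompletion_mk_eq_zero_iff x F hF S g).2 hg)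
  · intro h c hc
    obtain ⟨g, rfl⟩ := cechH0Mk_surjective x c
    refine (cechH0Mk_eq_zero_iff x (N := completion F hF S) g).2 ?_
    exact mem_range_cechDifferential_of_lim1 x _ h g
      ((cechToInducedCompletion_mk_eq_zero_iff x F hF S g).1 hc)

variable {x F hF}

/-- Everything is coordinatewise, so the same `m` serves all coordinates. -/
theorem isProZero_koszulH1Tower_directSum
    (h : (koszulH1Tower x (quotientTower F hF)).IsProZero) :
    (koszulH1Tower x (quotientTower (directSumFiltration S F)
      (directSumFiltration_antitone S hF))).IsProZero := by
  rw [isProZero_koszulH1Tower_iff] at h ⊢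
  intro n
  obtain ⟨m, hnm, hm⟩ := h n
  refine ⟨m, hnm, fun y hy => ?_⟩
  obtain ⟨f, rfl⟩ := Submodule.Quotient.mk_surjective _ y
  refine (Submodule.Quotient.mk_eq_zero _).2 fun s => ?_
  have hy' : x ^ (m : ℕ) • f ∈ directSumFiltration S F m := (Submodule.Quotient.mk_eq_zero _).1 hy
  exact (Submodule.Quotient.mk_eq_zero _).1
    (hm (Submodule.Quotient.mk (f s)) ((Submodule.Quotient.mk_eq_zero _).2 (hy' s)))

theorem isProZero_koszulH1Tower_polynomial {Y : ModuleTower.{u, v} R}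
    (h : (koszulH1Tower x Y).IsProZero) : (koszulH1Tower x Y.polynomial).IsProZero := by
  rw [isProZero_koszulH1Tower_iff] at h ⊢
  intro n
  obtain ⟨m, hnm, hm⟩ := h n
  refine ⟨m, hnm, fun y hy => PolynomialModule.ext (Finsupp.ext fun i => ?_)⟩
  exact hm (y.coeff i) (DFunLike.congr_fun (congrArg PolynomialModule.coeff hy) i)

theorem isProZero_of_koszulLimVanish_directSum {j : ℕ+ → S} (hj : Function.Injective j)
    (h : KoszulLimVanish x (quotientTower (directSumFiltration S F)
      (directSumFiltration_antitone S hF))) :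
    (koszulH1Tower x (quotientTower F hF)).IsProZero := by
  classical
  refine isProZero_koszulH1Tower_of_finite_support x
    (W := quotientTower (directSumFiltration S F) (directSumFiltration_antitone S hF))
    (fun n i => Submodule.mapQ _ _ (Finsupp.lapply (j i)) fun f hf => hf (j i))
    (fun n i => Submodule.mapQ _ _ (Finsupp.lsingle (j i)) fun y hy s => ?_) ?_ ?_ ?_ ?_ h
  · rw [Finsupp.lsingle_apply, Finsupp.single_apply]
    split_ifs
    · exact hy
    · exact zero_mem _
  · intro n m hnm i y
    obtain ⟨f, rfl⟩ := Submodule.Quotient.mk_surjective _ y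
    rfl
  · intro n m hnm i y
    obtain ⟨f, rfl⟩ := Submodule.Quotient.mk_surjective _ y
    rfl
  · intro n i i' y
    obtain ⟨f, rfl⟩ := Submodule.Quotient.mk_surjective _ y
    refine (congrArg Submodule.Quotient.mk
      ((Finsupp.single_apply (a := j i) (a' := j i') (b := f)))).trans ?_
    simp only [hj.eq_iff]
    split_ifs <;> rfl
  · intro n y
    obtain ⟨f, rfl⟩ := Submodule.Quotient.mk_surjective _ y
    refine (f.hasFiniteSupport.preimage hj.injOn).subset fun i hi h0 => hi ?_
    exact congrArg Submodule.Quotient.mk h0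

/-- The copies are the coefficients of positive degree. -/
theorem isProZero_of_koszulLimVanish_polynomial {Y : ModuleTower.{u, v} R}
    (h : KoszulLimVanish x Y.polynomial) : (koszulH1Tower x Y).IsProZero := by
  refine isProZero_koszulH1Tower_of_finite_support x (W := Y.polynomial)
    (fun n i => (Finsupp.lapply (i : ℕ)).comp
      (PolynomialModule.coeffLinearEquiv R R (M := Y.obj n)).toLinearMap)
    (fun n i => PolynomialModule.lsingle R (i : ℕ)) ?_ ?_ ?_ ?_ h
  · intro n m hnm i y
    rfl
  · intro n m hnm i z
    exact (PolynomialModule.map_lsingle R (Y.map hnm) (i : ℕ) z).symm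
  · intro n i j z
    refine (PolynomialModule.lsingle_apply (R := R) (i : ℕ) z (j : ℕ)).trans ?_
    simp only [PNat.coe_inj]
  · intro n y
    exact y.coeff.hasFiniteSupport.preimage PNat.coe_injective.injOn

end Filtration

theorem theorem4p2 {R : Type u} [CommRing R] {M : Type v} [AddCommGroup M] [Module R M]
    (F : ℕ+ → Submodule R M) (hF : Antitone F) (x : R) :
    List.TFAE [
      (koszulH1Tower x (quotientTower F hF)).IsProZero,
      ∀ S : Type w, CechCondition x F hF S,
      CechCondition x F hF Unit ∧ CechCondition x F hF ℕ,
      KoszulLimVanish x (quotientTower F hF) ∧ KoszulLimVanish x (quotientTower F hF).polynomial,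
      KoszulLimVanish x (quotientTower F hF).polynomial] := by
  tfae_have 1 → 2 := fun h S =>
    (cechCondition_iff x F hF S).2 (isProZero_koszulH1Tower_directSum S h).koszulLimVanish
  tfae_have 1 → 3 := fun h =>
    ⟨(cechCondition_iff x F hF Unit).2 (isProZero_koszulH1Tower_directSum Unit h).koszulLimVanish,
      (cechCondition_iff x F hF ℕ).2 (isProZero_koszulH1Tower_directSum ℕ h).koszulLimVanish⟩
  tfae_have 1 → 4 := fun h =>
    ⟨h.koszulLimVanish, (isProZero_koszulH1Tower_polynomial h).koszulLimVanish⟩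
  tfae_have 4 → 5 := And.right
  tfae_have 2 → 1 := fun h =>
    -- `S` ranges over the universe `w`, so ℕ is lifted to it.
    isProZero_of_koszulLimVanish_directSum (ULift.{w} ℕ) (j := fun i => ULift.up (i : ℕ))
      (fun _ _ h => PNat.coe_injective (ULift.up_injective h)) ((cechCondition_iff x F hF _).1 (h _))
  tfae_have 3 → 1 := fun h =>
    isProZero_of_koszulLimVanish_directSum ℕ PNat.coe_injective
      ((cechCondition_iff x F hF ℕ).1 h.2)
  tfae_have 5 → 1 := isProZero_of_koszulLimVanish_polynomial
  tfae_finish
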